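/- Let $M\ge 1$ and $n\ge 0$ be integers and let $f(x)=a_0x^n+a_1x^{n-1}+\cdots+a_n$ be a polynomial of degree $n$ with real coefficients and $a_0>0$. Put $a_k=0$ for integers $k<0$ and $k>n$, and let $H_M(f)=(a_{Mj-i})_{i,j=1}^{\infty}$ be the infinite generalized Hurwitz matrix of $f$. If $H_M(f)$ is totally nonnegative, i.e. every minor of $H_M(f)$ of every finite order is nonnegative, then $f$ has no zeros in the open sector $$\left\{z\in\mathbb{C}\setminus\{0\} : |\arg z|<\frac{\pi}{M}\right\},$$ where $\arg z\in(-\pi,\pi]$ is the principal argument. (A zero at the origin is not excluded.) -/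

import Mathlib

/-- A (possibly infinite) real matrix with linearly ordered row and column index sets is
totally nonnegative if all its minors, of every finite order `p`, with rows `r 0 < r 1 < ⋯` and
columns `c 0 < c 1 < ⋯`, are nonnegative. -/
def IsTotallyNonneg {ι κ : Type*} [LinearOrder ι] [LinearOrder κ] (A : Matrix ι κ ℝ) : Prop :=
  ∀ (p : ℕ) (r : Fin p ↪o ι) (c : Fin p ↪o κ), 0 ≤ (A.submatrix r c).det

/-- For `f = a₀ xⁿ + a₁ xⁿ⁻¹ + ⋯ + aₙ` of degree `n`, this is `aₖ`, with the convention
`aₖ = 0` for integers `k < 0` and `k > n`. -/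
noncomputable def descCoeff (f : Polynomial ℝ) (k : ℤ) : ℝ :=
  if 0 ≤ k ∧ k ≤ (f.natDegree : ℤ) then f.coeff (f.natDegree - k.toNat) else 0

/-- The infinite generalized Hurwitz matrix `H_M(f) = (a_{M j - i})`, `i, j = 1, 2, 3, …`.
The Lean indices start at `0`, so the Lean entry `(i, j)` is the entry in row `i + 1` and
column `j + 1`. -/
noncomputable def generalizedHurwitz (M : ℕ) (f : Polynomial ℝ) : Matrix ℕ ℕ ℝ :=
  Matrix.of fun i j => descCoeff f ((M : ℤ) * ((j : ℤ) + 1) - ((i : ℤ) + 1))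

/-! Suppose `z` is a zero with `0 ≤ arg z < π / M` (conjugation covers the rest). Then `u i = Im
(e^{iφ} z^i)` annihilates every column of index at least `n = deg f`. On the first `M * K` rows its
sign changes number at most about `M * K * arg z / π`, which falls below `K - n` for large `K`. A
small perturbation of `u` keeps these signs but makes the column sums strictly alternate. Merging
each block of constant sign into one row gives a totally nonnegative matrix with fewer rows than
alternating columns, against `IsTotallyNonneg.not_alternating`. -/

/-- Total nonnegativity passes to submatrices. -/
theorem IsTotallyNonneg.submatrix {ι κ ι' κ' : Type*} [LinearOrder ι] [LinearOrder κ]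
    [LinearOrder ι'] [LinearOrder κ'] {A : Matrix ι κ ℝ} (hA : IsTotallyNonneg A)
    (r : ι' ↪o ι) (c : κ' ↪o κ) : IsTotallyNonneg (A.submatrix r c) :=
  fun p r' c' => hA p (r'.trans r) (c'.trans c)

/-- Merging consecutive rows of a totally nonnegative matrix with nonnegative weights: if `β` is
monotone, the rows with the same value of `β` are replaced by one nonnegative combination. -/
theorem IsTotallyNonneg.mergeRows {κ : Type*} [LinearOrder κ] {A : Matrix ℕ κ ℝ}
    (hA : IsTotallyNonneg A) {β : ℕ → ℕ} (hβ : Monotone β) {w : ℕ → ℝ} (s : Finset ℕ)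
    (hw : ∀ i ∈ s, 0 ≤ w i) :
    IsTotallyNonneg (Matrix.of fun t j => ∑ i ∈ s with β i = t, w i * A i j) := by
  intro p r c
  have key : ((Matrix.of fun t j => ∑ i ∈ s with β i = t, w i * A i j).submatrix r c) =
      fun t => ∑ i ∈ s with β i = r t, w i • fun k => A i (c k) := by
    ext t k
    simp [Finset.sum_apply]
  have hdet := (Matrix.detRowAlternating (R := ℝ) (n := Fin p)).toMultilinearMap.map_sum_finset
    (fun _ i => w i • fun k => A i (c k)) (fun t => s.filter fun i => β i = r t)
  rw [key]
  refine le_of_le_of_eq ?_ hdet.symm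
  refine Finset.sum_nonneg fun g hg => ?_
  simp only [Fintype.mem_piFinset, Finset.mem_filter] at hg
  rw [MultilinearMap.map_smul_univ]
  refine smul_nonneg (Finset.prod_nonneg fun t _ => hw _ (hg t).1) ?_
  -- Each term of the multilinear expansion picks one row per block; blocks are ordered, so it is a
  -- genuine minor.
  have hmono : StrictMono g := by
    intro t t' h
    by_contra! hle
    have h1 := hβ hle
    rw [(hg t).2, (hg t').2] at h1
    exact absurd h1 (not_le.2 (r.strictMono h))
  exact hA p (OrderEmbedding.ofStrictMono g hmono) c

/-- No combination of `p` rows of a totally nonnegative matrix with `p + 1` columns has entries of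
strictly alternating signs. -/
theorem IsTotallyNonneg.not_alternating {p : ℕ} {B : Matrix (Fin p) (Fin (p + 1)) ℝ}
    (hB : IsTotallyNonneg B) {y : Fin (p + 1) → ℝ} (hy : y ∈ Submodule.span ℝ (Set.range B.row)) :
    ¬ ∀ j : Fin (p + 1), 0 < (-1) ^ (j : ℕ) * y j := by
  induction p with
  | zero =>
    intro h
    have h0 : y = 0 := by simpa [Set.range_eq_empty] using hy
    simpa [h0] using h 0
  | succ p ih =>
    intro h
    have hexp : ∀ v : Fin (p + 2) → ℝ, Matrix.det (Matrix.of (Fin.cons v B.row : Fin (p + 2) → _)) =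
        ∑ j : Fin (p + 2), (-1) ^ (j : ℕ) * v j * (B.submatrix id j.succAbove).det := by
      intro v
      rw [Matrix.det_succ_row_zero]
      rfl
    have hminor : ∀ j : Fin (p + 2), 0 ≤ (B.submatrix id j.succAbove).det := fun j =>
      hB (p + 1) (RelEmbedding.refl _) j.succAboveOrderEmb
    have hy0 : Matrix.det (Matrix.of (Fin.cons y B.row : Fin (p + 2) → _)) = 0 := by
      by_contra hne
      have hli := Matrix.linearIndependent_rows_of_det_ne_zero hne
      exact (linearIndependent_finCons.1 hli).2 hy
    -- Alternation makes every Laplace term nonnegative, so a zero sum kills all maximal minors. The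
    -- rows are then dependent, and one row and the last column can be dropped.
    have hzero : ∀ j : Fin (p + 2), (B.submatrix id j.succAbove).det = 0 := by
      rw [hexp, Finset.sum_eq_zero_iff_of_nonneg
        fun j _ => mul_nonneg (h j).le (hminor j)] at hy0
      intro j
      exact (mul_eq_zero.1 (hy0 j (Finset.mem_univ j))).resolve_left (h j).ne'
    have hdep : ¬ LinearIndependent ℝ B.row := by
      intro hli
      have hspan : Submodule.span ℝ (Set.range B.row) ≠ ⊤ := by
        intro htop
        have h1 := finrank_span_eq_card hli
        rw [htop, finrank_top] at h1
        simp at h1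
      obtain ⟨v, hv⟩ := SetLike.exists_not_mem_of_ne_top _ hspan
      have hli' := linearIndependent_finCons.2 ⟨hli, hv⟩
      have hunit := Matrix.linearIndependent_rows_iff_isUnit.1
        (show LinearIndependent ℝ
        (Matrix.of (Fin.cons v B.row : Fin (p + 2) → _)).row from hli')
      rw [Matrix.isUnit_iff_isUnit_det, hexp] at hunit
      simp [hzero] at hunit
    rw [linearIndependent_iff_notMem_span] at hdep
    push Not at hdep
    obtain ⟨t, ht⟩ := hdep
    have hspan : Submodule.span ℝ (Set.range B.row) ≤
        Submodule.span ℝ (Set.range fun i => B.row (t.succAbove i)) := by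
      have himg : B.row '' (Set.univ \ {t}) = Set.range fun i => B.row (t.succAbove i) := by
        rw [← Set.compl_eq_univ_sdiff, ← Fin.range_succAbove, ← Set.range_comp]
        rfl
      rw [himg] at ht
      rw [Submodule.span_le]
      rintro _ ⟨i, rfl⟩
      rcases Fin.eq_self_or_eq_succAbove t i with rfl | ⟨i, rfl⟩
      · exact ht
      · exact Submodule.subset_span ⟨i, rfl⟩
    refine ih (hB.submatrix t.succAboveOrderEmb Fin.castSuccOrderEmb)
      (y := fun j => y j.castSucc) ?_ fun j => h j.castSucc
    have := Submodule.mem_map_of_mem (f := LinearMap.funLeft ℝ ℝ (Fin.castSucc (n := p + 1)))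
      (hspan hy)
    rw [Submodule.map_span, ← Set.range_comp] at this
    exact this

theorem generalizedHurwitz_apply {M : ℕ} {f : Polynomial ℝ} {i j m : ℕ}
    (hm : M * (j + 1) = m + f.natDegree + 1) :
    generalizedHurwitz M f i j = if m ≤ i then f.coeff (i - m) else 0 := by
  have hk : (M : ℤ) * ((j : ℤ) + 1) - ((i : ℤ) + 1) = (m : ℤ) + f.natDegree - i := by
    have : (M : ℤ) * ((j : ℤ) + 1) = m + f.natDegree + 1 := mod_cast hm
    rw [this]; ring
  simp only [generalizedHurwitz, Matrix.of_apply, descCoeff, hk]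
  by_cases h1 : m ≤ i
  · by_cases h2 : i ≤ m + f.natDegree
    · rw [if_pos (by omega), if_pos h1]
      congr 1
      omega
    · rw [if_neg (by omega), if_pos h1, Polynomial.coeff_eq_zero_of_natDegree_lt (by omega)]
  · rw [if_neg (by omega), if_neg h1]

/-- The columns of the generalized Hurwitz matrix against the geometric progression of ratio
`z`. -/
theorem sum_pow_mul_generalizedHurwitz {M K : ℕ} (hM : 1 ≤ M) (f : Polynomial ℝ) (z : ℂ) {j : ℕ}
    (hj : f.natDegree ≤ j) (hjK : j < K) :
    ∑ i ∈ Finset.range (M * K), z ^ i * (generalizedHurwitz M f i j : ℂ) =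
      z ^ (M * (j + 1) - f.natDegree - 1) * Polynomial.aeval z f := by
  have h1 : f.natDegree + 1 ≤ M * (j + 1) := by nlinarith
  have h2 : M * (j + 1) ≤ M * K := Nat.mul_le_mul_left M hjK
  obtain ⟨m, hm⟩ : ∃ m, M * (j + 1) = m + f.natDegree + 1 :=
    ⟨M * (j + 1) - f.natDegree - 1, by omega⟩
  obtain ⟨l, hl⟩ : ∃ l, M * K = m + l := ⟨M * K - m, by omega⟩
  rw [Polynomial.aeval_eq_sum_range' (show f.natDegree < l by omega),
    show M * (j + 1) - f.natDegree - 1 = m by omega, hl, Finset.sum_range_add, Finset.mul_sum,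
    Finset.sum_eq_zero, zero_add]
  · refine Finset.sum_congr rfl fun p _ => ?_
    rw [generalizedHurwitz_apply hm, if_pos (by omega), Nat.add_sub_cancel_left, pow_add,
      Complex.real_smul]
    ring
  · intro i hi
    rw [generalizedHurwitz_apply hm, if_neg (by simpa using hi)]
    simp

/-- The first `K` columns of the generalized Hurwitz matrix are linearly independent already on
its first `M * K` rows. -/
theorem exists_sum_mul_generalizedHurwitz_eq {M : ℕ} (hM : 1 ≤ M) {f : Polynomial ℝ}
    (hf : f ≠ 0) (K : ℕ) (v : ℕ → ℝ) : ∃ w : ℕ → ℝ, ∀ j < K,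
      ∑ i ∈ Finset.range (M * K), w i * generalizedHurwitz M f i j = v j := by
  have hpos : ∀ t, 0 < M * (t + 1) := fun t => by positivity
  -- These rows carry `a₀` on the diagonal and zeros below it.
  let T : Matrix (Fin K) (Fin K) ℝ := Matrix.of fun t j =>
    generalizedHurwitz M f (M * (t + 1) - 1) j
  have hentry : ∀ t j : ℕ, generalizedHurwitz M f (M * (t + 1) - 1) j =
      descCoeff f (M * ((j : ℤ) - t)) := by
    intro t j
    simp only [generalizedHurwitz, Matrix.of_apply]
    congr 1
    have := hpos t
    push_cast [Nat.cast_sub (show 1 ≤ M * (t + 1) from this)]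
    ring
  have hT : T.IsUpperTriangular := by
    intro t j h
    have h' : (j : ℤ) - (t : ℤ) < 0 := by simpa using h
    have : (M : ℤ) * ((j : ℤ) - t) < 0 := mul_neg_of_pos_of_neg (by omega) h'
    change generalizedHurwitz M f (M * (t + 1) - 1) j = 0
    rw [hentry, descCoeff, if_neg (by omega)]
  have hdet : IsUnit T.det := by
    rw [Matrix.det_of_isUpperTriangular hT, isUnit_iff_ne_zero, Finset.prod_ne_zero_iff]
    intro t _
    change generalizedHurwitz M f (M * (t + 1) - 1) t ≠ 0
    rw [hentry]
    simpa [descCoeff] using hf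
  let x : Fin K → ℝ := Matrix.vecMul (fun j : Fin K => v j) T⁻¹
  have hx : Matrix.vecMul x T = fun j : Fin K => v j := by
    simp [x, Matrix.vecMul_vecMul, Matrix.nonsing_inv_mul _ hdet]
  refine ⟨fun i => ∑ t : Fin K, if i = M * (t + 1) - 1 then x t else 0, fun j hj => ?_⟩
  refine Eq.trans ?_ (congrFun hx ⟨j, hj⟩)
  simp only [Finset.sum_mul, ite_mul, zero_mul]
  rw [Finset.sum_comm]
  refine Finset.sum_congr rfl fun t _ => ?_
  have ht : M * (t + 1) ≤ M * K := Nat.mul_le_mul_left M t.2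
  have := hpos t
  rw [Finset.sum_ite_eq', if_pos (Finset.mem_range.2 (by omega))]
  rfl

theorem Real.neg_one_pow_floor_mul_sin_nonneg {x : ℝ} (hx : 0 ≤ x) :
    0 ≤ (-1) ^ ⌊x / Real.pi⌋₊ * Real.sin x := by
  have h1 := Nat.floor_le (div_nonneg hx Real.pi_pos.le)
  have h2 := Nat.lt_floor_add_one (x / Real.pi)
  rw [le_div_iff₀ Real.pi_pos] at h1
  rw [div_lt_iff₀ Real.pi_pos] at h2
  rw [← Real.sin_sub_nat_mul_pi]
  exact Real.sin_nonneg_of_nonneg_of_le_pi (by linarith) (by linarith)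

/-- Only countably many phases are bad. A generic one gives every `u i` a strict sign, which
survives perturbation. -/
theorem exists_phase_sin_ne_zero (θ : ℝ) :
    ∃ φ ∈ Set.Ioo 0 Real.pi, ∀ i : ℕ, Real.sin (φ + i * θ) ≠ 0 := by
  have hcount : (Set.range fun q : ℤ × ℕ => (q.1 : ℝ) * Real.pi - q.2 * θ).Countable :=
    Set.countable_range _
  obtain ⟨φ, hφ, hmem⟩ := (hcount.dense_compl ℝ).exists_mem_open isOpen_Ioo
    (Set.nonempty_Ioo.2 Real.pi_pos)
  refine ⟨φ, hmem, fun i h => hφ ?_⟩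
  obtain ⟨k, hk⟩ := Real.sin_eq_zero_iff.1 h
  exact ⟨(k, i), by simp [hk]⟩

theorem aeval_ne_zero_of_arg_nonneg {M : ℕ} (hM : 1 ≤ M) {f : Polynomial ℝ} (hf : f ≠ 0)
    (hTN : IsTotallyNonneg (generalizedHurwitz M f)) {z : ℂ} (hz : z ≠ 0) (h0 : 0 ≤ z.arg)
    (hlt : z.arg < Real.pi / M) : Polynomial.aeval z f ≠ 0 := by
  intro hzero
  have hMpos : (0 : ℝ) < M := by exact_mod_cast hM
  have hπ := Real.pi_pos
  obtain ⟨φ, ⟨hφ0, hφπ⟩, hφ⟩ := exists_phase_sin_ne_zero z.arg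
  set u : ℕ → ℝ := fun i => (Complex.exp (φ * Complex.I) * z ^ i).im with hu
  have hu_eq : ∀ i, u i = ‖z‖ ^ i * Real.sin (φ + i * z.arg) := by
    intro i
    have h1 : Complex.exp (φ * Complex.I) * z ^ i =
        ((‖z‖ ^ i : ℝ) : ℂ) * Complex.exp (((φ + i * z.arg : ℝ) : ℂ) * Complex.I) := by
      conv_lhs => rw [← Complex.norm_mul_exp_arg_mul_I z]
      rw [mul_pow, ← Complex.exp_nat_mul, mul_left_comm, ← Complex.exp_add]
      push_cast
      congr 2
      ring
    simp only [hu, h1, Complex.im_ofReal_mul, Complex.exp_ofReal_mul_I_im]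
  have hu_ne : ∀ i, u i ≠ 0 := fun i => by
    rw [hu_eq]
    exact mul_ne_zero (pow_ne_zero _ (norm_ne_zero_iff.2 hz)) (hφ i)
  -- `β i` counts completed half-turns, so `u i` has sign `(-1) ^ β i`.
  set β : ℕ → ℕ := fun i => ⌊(φ + i * z.arg) / Real.pi⌋₊ with hβ
  have hβmono : Monotone β := fun i i' h => by
    simp only [hβ]
    gcongr
  have hu_sign : ∀ i, 0 < (-1) ^ β i * u i := by
    intro i
    refine lt_of_le_of_ne ?_ (mul_ne_zero (pow_ne_zero _ (by norm_num)) (hu_ne i)).symm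
    rw [hu_eq, mul_left_comm]
    exact mul_nonneg (by positivity)
      (Real.neg_one_pow_floor_mul_sin_nonneg (add_nonneg hφ0.le (by positivity)))
  set n := f.natDegree with hn
  -- Room for `β (M * K) + 2` columns starting at `n`, one more than the `β (M * K) + 1` blocks.
  obtain ⟨K, hK⟩ : ∃ K : ℕ, β (M * K) + 2 + n ≤ K := by
    have hgap : 0 < 1 - M * z.arg / Real.pi := by
      rw [sub_pos, div_lt_one hπ, mul_comm]
      exact (lt_div_iff₀ hMpos).1 hlt
    obtain ⟨K, hK⟩ := exists_nat_ge ((n + 3) / (1 - M * z.arg / Real.pi))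
    refine ⟨K, ?_⟩
    rw [div_le_iff₀ hgap] at hK
    have h1 : (β (M * K) : ℝ) ≤ (φ + (M * K : ℕ) * z.arg) / Real.pi :=
      Nat.floor_le (by positivity)
    have h2 : (φ + (M * K : ℕ) * z.arg) / Real.pi ≤ 1 + K * (M * z.arg / Real.pi) := by
      rw [add_div]
      refine add_le_add ((div_le_one hπ).2 hφπ.le) (le_of_eq ?_)
      push_cast
      ring
    have : (β (M * K) : ℝ) + 2 + n ≤ K := by linarith
    exact_mod_cast this
  -- The shift by `n` makes column `n + j` receive the sign `(-1) ^ j`.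
  obtain ⟨w, hw⟩ := exists_sum_mul_generalizedHurwitz_eq hM hf K fun j => (-1) ^ (j + n)
  obtain ⟨δ, hδ, hδu⟩ : ∃ δ > 0, ∀ i ∈ Finset.range (M * K),
      0 < (-1) ^ β i * (u i + δ * w i) := by
    have hev : ∀ᶠ δ in nhds (0 : ℝ), ∀ i ∈ Finset.range (M * K),
        0 < (-1) ^ β i * (u i + δ * w i) := by
      rw [Filter.eventually_all_finset]
      intro i _
      have hc : ContinuousAt (fun δ : ℝ => (-1) ^ β i * (u i + δ * w i)) 0 := by fun_prop
      exact hc.eventually_const_lt (by simpa using hu_sign i)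
    obtain ⟨δ, h1, h2⟩ := ((hev.filter_mono nhdsWithin_le_nhds).and
      (self_mem_nhdsWithin (s := Set.Ioi (0 : ℝ)))).exists
    exact ⟨δ, h2, h1⟩
  set p := β (M * K) + 1 with hp
  have hB := hTN.mergeRows hβmono (Finset.range (M * K)) fun i hi => (hδu i hi).le
  have hcol : StrictMono fun j : Fin (p + 1) => n + (j : ℕ) := fun a b h => by simpa using h
  refine (hB.submatrix (Fin.valOrderEmb p) (OrderEmbedding.ofStrictMono _ hcol)).not_alternating
    (y := fun j => δ * (-1) ^ (j : ℕ)) ?_ ?_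
  · refine (Submodule.mem_span_range_iff_exists_fun ℝ).2 ⟨fun t => (-1) ^ (t : ℕ), ?_⟩
    ext j
    have hj : n + (j : ℕ) < K := by omega
    have hsum : ∑ i ∈ Finset.range (M * K), u i * generalizedHurwitz M f i (n + j) = 0 := by
      have h1 := sum_pow_mul_generalizedHurwitz hM f z (Nat.le_add_right n j) hj
      rw [hzero, mul_zero] at h1
      have h2 := congrArg (fun x => (Complex.exp (φ * Complex.I) * x).im) h1
      simpa only [Finset.mul_sum, Complex.im_sum, ← mul_assoc, Complex.im_mul_ofReal, mul_zero,
        Complex.zero_im] using h2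
    have hlt : ∀ i ∈ Finset.range (M * K), β i ∈ Finset.range p := fun i hi =>
      Finset.mem_range.2 (Nat.lt_succ_of_le (hβmono (Finset.mem_range.1 hi).le))
    simp only [Finset.sum_apply, Pi.smul_apply, Matrix.row_apply, Matrix.submatrix_apply, Matrix.of_apply,
      smul_eq_mul, Fin.valOrderEmb_apply, OrderEmbedding.coe_ofStrictMono]
    rw [Fin.sum_univ_eq_sum_range (fun t => (-1 : ℝ) ^ t * ∑ i ∈ Finset.range (M * K) with β i = t,
      (-1) ^ β i * (u i + δ * w i) * generalizedHurwitz M f i (n + j)) p]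
    calc _ = ∑ t ∈ Finset.range p, ∑ i ∈ Finset.range (M * K) with β i = t,
          (u i + δ * w i) * generalizedHurwitz M f i (n + j) := by
          refine Finset.sum_congr rfl fun t _ => ?_
          rw [Finset.mul_sum]
          refine Finset.sum_congr rfl fun i hi => ?_
          rw [(Finset.mem_filter.1 hi).2, ← mul_assoc, ← mul_assoc, ← mul_pow]
          simp
      _ = ∑ i ∈ Finset.range (M * K), (u i + δ * w i) * generalizedHurwitz M f i (n + j) :=
          Finset.sum_fiberwise_of_maps_to hlt _
      _ = δ * (-1) ^ (j : ℕ) := by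
          simp only [add_mul, Finset.sum_add_distrib, hsum, mul_assoc, ← Finset.mul_sum,
            hw _ hj, zero_add]
          rw [show n + (j : ℕ) + n = j + 2 * n by ring, pow_add, pow_mul]
          simp
  · intro j
    rw [mul_left_comm, ← mul_pow]
    simpa using hδ

theorem mainTheorem1 (M : ℕ) (hM : 1 ≤ M) (f : Polynomial ℝ) (ha₀ : 0 < f.leadingCoeff)
    (hTN : IsTotallyNonneg (generalizedHurwitz M f)) :
    ∀ z : ℂ, z ≠ 0 → |z.arg| < Real.pi / (M : ℝ) → Polynomial.aeval z f ≠ 0 := by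
  intro z hz harg
  have hf : f ≠ 0 := Polynomial.leadingCoeff_ne_zero.1 ha₀.ne'
  rcases le_or_gt 0 z.arg with h | h
  · exact aeval_ne_zero_of_arg_nonneg hM hf hTN hz h (by rwa [abs_of_nonneg h] at harg)
  · have hconj : (starRingEnd ℂ z).arg = -z.arg := by
      rw [Complex.arg_conj, if_neg (by linarith [Real.pi_pos])]
    have := aeval_ne_zero_of_arg_nonneg hM hf hTN (z := starRingEnd ℂ z) (by simpa using hz)
      (by linarith) (by rwa [hconj, ← abs_of_neg h])
    rw [Polynomial.aeval_conj] at this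
    simpa using this
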